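/- Let $(X,d,m)$ be a metric measure space, i.e. $(X,d)$ is a complete and separable metric space and $m\neq 0$ is a non-negative Borel measure on $X$ that is finite on bounded sets. Let $q\in(1,\infty)$ and let $p=q/(q-1)$ be its conjugate exponent. Equip $C([0,1],X)$ with the uniform distance. A curve $\gamma\in C([0,1],X)$ belongs to $AC^q([0,1],X)$ if there is $g\in L^q(0,1)$ with $d(\gamma_s,\gamma_t)\le\int_s^t g(r)\,dr$ for all $0\le s\le t\le 1$; its metric speed is $|\dot\gamma_t|=\lim_{h\downarrow 0}d(\gamma_{t+h},\gamma_t)/h$, which exists for a.e. $t\in[0,1]$. Put $\mathrm{Ke}_q(\gamma)=\int_0^1|\dot\gamma_t|^q\,dt$ if $\gamma\in AC^q([0,1],X)$ and $\mathrm{Ke}_q(\gamma)=+\infty$ otherwise. A $q$-test plan is a Borel probability measure $\pi$ on $C([0,1],X)$ such that (i) there is $C>0$ such that, for every $t\in[0,1]$, the push-forward of $\pi$ under $\gamma\mapsto\gamma_t$ is $\le C\,m$; (ii) $\int\mathrm{Ke}_q(\gamma)\,d\pi(\gamma)<\infty$. For a Borel function $f\colon X\to\mathbb R$, a function $G\in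 L^p(m)$ with $G\ge 0$ is called a $p$-weak upper gradient of $f$ if $$\int|f(\gamma_1)-f(\gamma_0)|\,d\pi(\gamma)\le\int\!\int_0^1 G(\gamma_t)\,|\dot\gamma_t|\,dt\,d\pi(\gamma)\qquad\text{for every $q$-test plan }\pi,$$ and $S^p(X)$ is the class of all Borel functions $f\colon X\to\mathbb R$ that have a $p$-weak upper gradient. Then there exists a master $q$-test plan, that is, a $q$-test plan $\pi_q$ with the following property: whenever $f\colon X\to\mathbb R$ is Borel and $G\in L^p(m)$ with $G\ge 0$ are such that $$|f(\gamma_1)-f(\gamma_0)|\le\int_0^1 G(\gamma_t)\,|\dot\gamma_t|\,dt\qquad\text{for $\pi_q$-a.e. }\gamma,$$ then $f\in S^p(X)$ and $G$ is a $p$-weak upper gradient of $f$. -/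

import Mathlib

open MeasureTheory Filter
open scoped ENNReal NNReal Topology unitInterval

noncomputable section

namespace MasterPlan

/-- The Borel σ-algebra on `C([0,1], X)`. The topology is the compact-open one, which for metric `X`
is induced by the uniform distance. -/
instance instMeasurableSpaceCurves {X : Type*} [TopologicalSpace X] : MeasurableSpace C(I, X) :=
  borel C(I, X)

instance instBorelSpaceCurves {X : Type*} [TopologicalSpace X] : BorelSpace C(I, X) := ⟨rfl⟩

variable {X : Type*} [MetricSpace X]

/-- `γ ∈ AC^q([0,1], X)`: there is `g ∈ L^q(0,1)` with `d(γ_s, γ_t) ≤ ∫_s^t g` for all `s ≤ t`.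
Here `[0,1]` carries the Lebesgue measure. -/
def IsACq (q : ℝ) (γ : C(I, X)) : Prop :=
  ∃ g : I → ℝ, MemLp g (ENNReal.ofReal q) volume ∧
    ∀ s t : I, s ≤ t → dist (γ s) (γ t) ≤ ∫ r in Set.Icc s t, g r

/-- The metric speed `|γ̇_t| = lim_{s ↓ t} d(γ_s, γ_t) / (s - t)`. It is written as an upper limit,
so that it is defined for every curve and every time; for absolutely continuous curves the limit
exists for almost every `t`. -/
def metricSpeed (γ : C(I, X)) (t : I) : ℝ≥0∞ :=
  limsup (fun s : I => edist (γ s) (γ t) / edist s t) (𝓝[>] t)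

open Classical in
/-- The `q`-kinetic energy `∫_0^1 |γ̇_t|^q dt` of a curve, `+∞` outside `AC^q`. -/
def kineticEnergy (q : ℝ) (γ : C(I, X)) : ℝ≥0∞ :=
  if IsACq q γ then ∫⁻ t : I, metricSpeed γ t ^ q else ∞

/-- The integral `∫_0^1 G(γ_t) |γ̇_t| dt` of a function `G ≥ 0` along a curve, in `[0,∞]`. -/
def curveIntegral (G : X → ℝ) (γ : C(I, X)) : ℝ≥0∞ :=
  ∫⁻ t : I, ENNReal.ofReal (G (γ t)) * metricSpeed γ t

variable [MeasurableSpace X]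

/-- `q`-test plans: Borel probability measures on `C([0,1], X)` with bounded compression and finite
`q`-kinetic energy. -/
structure IsTestPlan (m : Measure X) (q : ℝ) (π : Measure C(I, X)) : Prop where
  isProbabilityMeasure : IsProbabilityMeasure π
  compression : ∃ C : ℝ≥0, 0 < C ∧ ∀ t : I, π.map (fun γ : C(I, X) => γ t) ≤ C • m
  energy : ∫⁻ γ, kineticEnergy q γ ∂π < ∞

/-- `G ∈ L^p(m)`, `G ≥ 0`, is a `p`-weak upper gradient of `f`: the integrated inequality holds for
every `q`-test plan, `q` the conjugate exponent of `p`. Both sides are integrals in `[0,∞]`. -/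
structure IsWeakUpperGradient (m : Measure X) (p : ℝ) (f G : X → ℝ) : Prop where
  memLp : MemLp G (ENNReal.ofReal p) m
  nonneg : 0 ≤ᵐ[m] G
  le_of_testPlan : ∀ π : Measure C(I, X), IsTestPlan m p.conjExponent π →
    ∫⁻ γ, ENNReal.ofReal |f (γ 1) - f (γ 0)| ∂π ≤ ∫⁻ γ, curveIntegral G γ ∂π

/-- The Sobolev class `S^p(X)`: Borel functions that have a `p`-weak upper gradient. -/
def SobolevClass (m : Measure X) (p : ℝ) : Set (X → ℝ) :=
  {f | Measurable f ∧ ∃ G : X → ℝ, IsWeakUpperGradient m p f G}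

/-- Master `q`-test plans, with `p` the conjugate exponent of `q`. -/
structure IsMasterTestPlan (m : Measure X) (q : ℝ) (π : Measure C(I, X)) : Prop where
  isTestPlan : IsTestPlan m q π
  detects : ∀ f G : X → ℝ, Measurable f →
    MemLp G (ENNReal.ofReal q.conjExponent) m → 0 ≤ᵐ[m] G →
    (∀ᵐ γ ∂π, ENNReal.ofReal |f (γ 1) - f (γ 0)| ≤ curveIntegral G γ) →
    f ∈ SobolevClass m q.conjExponent ∧ IsWeakUpperGradient m q.conjExponent f G

end MasterPlan

end

/-! For bounded `f` the signed inequality `∫ (f(γ₁) - f(γ₀)) dπ ≤ ∫∫ G(γ_t)|γ̇_t| dt dπ` sees a plan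
`π` only through three `m`-densities: those of its two endpoint marginals, in `L¹`, and that of
`speedMeasure π`, in `L^q` by Hölder and duality (`memLp_rnDeriv_speedMeasure`). It is a closed
condition on this triple, as `f ∈ L^∞` and `G ∈ L^p` pair continuously with it. Since `L¹ × L¹ ×
L^q` is separable, countably many plans decide the inequality for all plans, uniformly in `f` and
`G` (`exists_seq_isFinitePlan_dense`).

A weighted sum of these plans, normalized, is the master plan. Its null sets are null for each
summand, so the curvewise inequality passes to each summand and can be integrated there.

The signed inequality for all plans recovers the absolute value: restrict a plan to the curves with
`f(γ₀) ≤ f(γ₁)` and to the complement, using `-f` there. This is why total mass one is not imposed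
on plans in between. Truncation and Fatou remove the bound on `f`. -/

noncomputable section

namespace MasterPlan

/-! ### Duality between `L^p` and `L^q`. -/

section Duality

variable {X : Type*} [MeasurableSpace X]

/-- Converse Hölder inequality: a function that pairs boundedly with `L^p` belongs to `L^q`. -/
lemma lintegral_rpow_le_of_forall_lintegral_mul_le {m : Measure X} [SigmaFinite m] {p q : ℝ}
    (hpq : p.HolderConjugate q) {h : X → ℝ≥0∞} (hh : Measurable h) {K : ℝ≥0∞}
    (hK : ∀ g : X → ℝ≥0∞, Measurable g →
      ∫⁻ x, g x * h x ∂m ≤ K * (∫⁻ x, g x ^ p ∂m) ^ (1 / p)) :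
    ∫⁻ x, h x ^ q ∂m ≤ K ^ q := by
  have hp := hpq.pos
  have hq := hpq.symm.pos
  have hq1 : 0 ≤ q - 1 := hpq.symm.sub_one_pos.le
  set B := spanningSets m
  -- Truncate in height and in space: `∫ (u n)^q` is then finite, so a power of it can be cancelled
  -- below.
  set u : ℕ → X → ℝ≥0∞ := fun n => (B n).indicator fun x => min (h x) n
  have hu : ∀ n, Measurable (u n) := fun n =>
    (hh.min measurable_const).indicator (measurableSet_spanningSets m n)
  have hule : ∀ n x, u n x ≤ h x := fun n x =>
    (Set.indicator_le_self _ _ x).trans (min_le_left _ _)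
  have hmono : Monotone u := by
    intro a b hab x
    refine (Set.indicator_le_indicator_of_subset (monotone_spanningSets m hab)
      (fun _ => zero_le) x).trans (Set.indicator_le_indicator ?_)
    exact min_le_min le_rfl (by exact_mod_cast hab)
  have hsup : ∀ x, ⨆ n, u n x = h x := by
    intro x
    refine le_antisymm (iSup_le fun n => hule n x) (le_of_forall_lt fun a ha => ?_)
    obtain ⟨k, hk⟩ := ENNReal.exists_nat_gt (ne_top_of_lt ha)
    obtain ⟨l, hl⟩ : ∃ l, x ∈ B l := ⟨_, mem_spanningSetsIndex m x⟩
    refine lt_of_lt_of_le ?_ (le_iSup (fun n => u n x) (max k l))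
    have hx : x ∈ B (max k l) := monotone_spanningSets m (le_max_right _ _) hl
    simp only [u, Set.indicator_of_mem hx]
    exact lt_min ha (hk.trans_le (by exact_mod_cast le_max_left k l))
  have hfin : ∀ n, ∫⁻ x, u n x ^ q ∂m ≠ ∞ := by
    intro n
    have : ∫⁻ x, u n x ^ q ∂m ≤ ∫⁻ x, (B n).indicator (fun _ => (n : ℝ≥0∞) ^ q) x ∂m := by
      refine lintegral_mono fun x => ?_
      by_cases hx : x ∈ B n
      · simp only [u, Set.indicator_of_mem hx]
        exact ENNReal.rpow_le_rpow (min_le_right _ _) hq.le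
      · simp [u, hx, hq]
    refine ne_top_of_le_ne_top ?_ this
    rw [lintegral_indicator_const (measurableSet_spanningSets m n)]
    exact ENNReal.mul_ne_top (ENNReal.rpow_ne_top_of_nonneg hq.le (ENNReal.natCast_ne_top n))
      (measure_spanningSets_lt_top m n).ne
  have key : ∀ n, ∫⁻ x, u n x ^ q ∂m ≤ K ^ q := by
    intro n
    set J := ∫⁻ x, u n x ^ q ∂m with hJ
    have h1 : J ≤ K * J ^ (1 / p) := by
      -- The extremal test function in Hölder's inequality: `(q - 1) p = q`.
      have h2 := hK (fun x => u n x ^ (q - 1)) ((hu n).pow_const _)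
      have h3 : ∀ x, (u n x ^ (q - 1)) ^ p = u n x ^ q := fun x => by
        rw [← ENNReal.rpow_mul, hpq.symm.sub_one_mul_conj]
      simp only [h3] at h2
      refine le_trans (lintegral_mono fun x => ?_) h2
      calc u n x ^ q = u n x ^ ((q - 1) + 1) := by ring_nf
        _ = u n x ^ (q - 1) * u n x := by
          rw [ENNReal.rpow_add_of_nonneg _ _ hq1 zero_le_one, ENNReal.rpow_one]
        _ ≤ u n x ^ (q - 1) * h x := by gcongr; exact hule n x
    rcases eq_or_ne J 0 with h0 | h0
    · rw [h0]; exact zero_le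
    have h4 : J ^ (1 / q) ≤ K := by
      have h5 : J = J ^ (1 / q) * J ^ (1 / p) := by
        rw [← ENNReal.rpow_add _ _ h0 (hfin n)]
        have : 1 / q + 1 / p = 1 := by
          simpa [add_comm] using hpq.inv_add_inv_eq_one
        rw [this, ENNReal.rpow_one]
      have hc0 : J ^ (1 / p) ≠ 0 := by
        simp [ENNReal.rpow_eq_zero_iff, h0, hp.le]
      have hct : J ^ (1 / p) ≠ ∞ := ENNReal.rpow_ne_top_of_nonneg (by positivity) (hfin n)
      have h6 : J ^ (1 / q) * J ^ (1 / p) ≤ K * J ^ (1 / p) := h5 ▸ h1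
      exact (ENNReal.mul_le_mul_iff_left hc0 hct).1 h6
    calc J = (J ^ (1 / q)) ^ q := by
          rw [← ENNReal.rpow_mul, one_div_mul_cancel hq.ne', ENNReal.rpow_one]
      _ ≤ K ^ q := ENNReal.rpow_le_rpow h4 hq.le
  calc ∫⁻ x, h x ^ q ∂m = ∫⁻ x, ⨆ n, u n x ^ q ∂m := by
        refine lintegral_congr fun x => ?_
        rw [← hsup x]
        exact (ENNReal.orderIsoRpow q hq).map_iSup _
    _ = ⨆ n, ∫⁻ x, u n x ^ q ∂m := by
        refine lintegral_iSup (fun n => (hu n).pow_const _) fun a b hab x => ?_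
        exact ENNReal.rpow_le_rpow (hmono hab x) hq.le
    _ ≤ K ^ q := iSup_le key

/-- Turns integration against `μ` into a pairing that is continuous in the density of `μ`. -/
lemma lpPairing_toLp_rnDeriv {m μ : Measure X} [SigmaFinite m] [IsFiniteMeasure μ]
    (hμ : μ ≪ m) {r s : ℝ≥0∞} [Fact (1 ≤ r)] [Fact (1 ≤ s)] [r.HolderConjugate s]
    {F : X → ℝ} (hF : MemLp F r m) (hd : MemLp (fun x => (μ.rnDeriv m x).toReal) s m) :
    (ContinuousLinearMap.mul ℝ ℝ).lpPairing m r s (hF.toLp F) (hd.toLp _) = ∫ x, F x ∂μ := by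
  rw [ContinuousLinearMap.lpPairing_eq_integral, ← integral_rnDeriv_smul hμ]
  refine integral_congr_ae ?_
  filter_upwards [hF.coeFn_toLp, hd.coeFn_toLp] with x h1 h2
  rw [h1, h2]
  simp [mul_comm]

end Duality

/-! ### Measurability of the metric speed. -/

section Speed

variable {X : Type*} [MetricSpace X]

/-- The difference quotient is continuous in `s ≠ t`, so its supremum over an open set is attained
along a dense set. A countable `D` then gives joint measurability in `(γ, t)`. -/
lemma metricSpeed_eq_iInf_iSup {D : Set I} (hD : Dense D) (γ : C(I, X)) (t : I) :
    metricSpeed γ t = ⨅ n : ℕ, ⨆ s ∈ D,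
      (Metric.ball t (1 / ((n : ℝ) + 1)) ∩ Set.Ioi t).indicator
        (fun z => edist (γ z) (γ t) / edist z t) s := by
  rw [metricSpeed,
    (nhdsWithin_hasBasis Metric.nhds_basis_ball_inv_nat_succ (Set.Ioi t)).limsup_eq_iInf_iSup]
  simp only [iInf_pos]
  refine iInf_congr fun n => le_antisymm (iSup₂_le fun s hs => ?_) (iSup₂_le fun s _ => ?_)
  · refine le_of_forall_lt fun a ha => ?_
    have hst : edist s t ≠ 0 := edist_eq_zero.not.2 (ne_of_gt hs.2)
    have hc : ContinuousAt (fun z => edist (γ z) (γ t) / edist z t) s :=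
      ENNReal.Tendsto.div ((γ.continuous.edist continuous_const).tendsto s) (Or.inr hst)
        ((continuous_id.edist continuous_const).tendsto s) (Or.inr (edist_ne_top _ _))
    have hU : Metric.ball t (1 / ((n : ℝ) + 1)) ∩ Set.Ioi t ∈ 𝓝 s :=
      (Metric.isOpen_ball.inter isOpen_Ioi).mem_nhds hs
    obtain ⟨z, ⟨hzU, hza⟩, hzD⟩ :=
      mem_closure_iff_nhds.1 (hD s) _ (inter_mem hU (hc.eventually (lt_mem_nhds ha)))
    refine lt_of_lt_of_le ?_ (le_iSup₂ z hzD)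
    rw [Set.indicator_of_mem hzU]
    exact hza
  · by_cases hs : s ∈ Metric.ball t (1 / ((n : ℝ) + 1)) ∩ Set.Ioi t
    · rw [Set.indicator_of_mem hs]
      exact le_iSup₂ (f := fun z (_ : z ∈ Metric.ball t (1 / ((n : ℝ) + 1)) ∩ Set.Ioi t) =>
        edist (γ z) (γ t) / edist z t) s hs
    · rw [Set.indicator_of_notMem hs]
      exact zero_le

lemma measurable_metricSpeed :
    Measurable fun z : C(I, X) × I => metricSpeed z.1 z.2 := by
  obtain ⟨D, hDc, hD⟩ := TopologicalSpace.exists_countable_dense I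
  simp only [metricSpeed_eq_iInf_iSup hD]
  refine Measurable.iInf fun n => Measurable.biSup D hDc fun s _ => ?_
  have hset : MeasurableSet {z : C(I, X) × I |
      s ∈ Metric.ball z.2 (1 / ((n : ℝ) + 1)) ∩ Set.Ioi z.2} := by
    refine IsOpen.measurableSet ?_
    have h1 : IsOpen {z : C(I, X) × I | dist s z.2 < 1 / ((n : ℝ) + 1)} :=
      isOpen_lt (by fun_prop) (by fun_prop)
    have h2 : IsOpen {z : C(I, X) × I | z.2 < s} := isOpen_lt (by fun_prop) (by fun_prop)
    exact h1.inter h2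
  have hfun : Measurable fun z : C(I, X) × I => edist (z.1 s) (z.1 z.2) / edist s z.2 := by
    refine Measurable.div (Continuous.measurable ?_) (Continuous.measurable ?_)
    · exact Continuous.edist (by fun_prop) (by fun_prop)
    · exact Continuous.edist (by fun_prop) (by fun_prop)
  exact hfun.indicator hset

lemma lintegral_metricSpeed_rpow_le_kineticEnergy (q : ℝ) (γ : C(I, X)) :
    ∫⁻ t : I, metricSpeed γ t ^ q ≤ kineticEnergy q γ := by
  unfold kineticEnergy
  split_ifs
  · exact le_rfl
  · exact le_top

lemma kineticEnergy_const {q : ℝ} (hq : 0 < q) (x : X) :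
    kineticEnergy q (ContinuousMap.const I x) = 0 := by
  have hac : IsACq q (ContinuousMap.const I x) := ⟨0, MemLp.zero, by simp⟩
  have hs : ∀ t, metricSpeed (ContinuousMap.const I x) t = 0 := fun t => by
    have : (fun s : I => edist ((ContinuousMap.const I x) s) ((ContinuousMap.const I x) t) /
        edist s t) = fun _ => (⊥ : ℝ≥0∞) := by
      ext s; simp
    rw [metricSpeed, this, limsup_const_bot]
    rfl
  rw [kineticEnergy, if_pos hac]
  simp [hs, hq]

end Speed

/-! ### Finite plans and their speed measures. -/

section Plans

variable {X : Type*} [MetricSpace X] [MeasurableSpace X]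

/-- Test plans without the normalization to total mass one. -/
structure IsFinitePlan (m : Measure X) (q : ℝ) (π : Measure C(I, X)) : Prop where
  isFiniteMeasure : IsFiniteMeasure π
  compression : ∃ C : ℝ≥0, ∀ t : I, π.map (fun γ : C(I, X) => γ t) ≤ C • m
  energy : ∫⁻ γ, kineticEnergy q γ ∂π < ∞

/-- The measure `∫ ∫_0^1 |γ̇_t| δ_{γ_t} dt dπ(γ)`. -/
def speedMeasure (π : Measure C(I, X)) : Measure X :=
  ((π.prod volume).withDensity fun z : C(I, X) × I => metricSpeed z.1 z.2).map fun z => z.1 z.2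

variable {m : Measure X} {p q : ℝ} {π : Measure C(I, X)}

lemma IsTestPlan.isFinitePlan (h : IsTestPlan m q π) : IsFinitePlan m q π where
  isFiniteMeasure := have := h.isProbabilityMeasure; inferInstance
  compression := let ⟨C, _, hC⟩ := h.compression; ⟨C, hC⟩
  energy := h.energy

lemma isFinitePlan_zero : IsFinitePlan m q (0 : Measure C(I, X)) where
  isFiniteMeasure := inferInstance
  compression := ⟨0, fun t => by simp⟩
  energy := by simp

lemma IsFinitePlan.map_eval_absolutelyContinuous (h : IsFinitePlan m q π) (t : I) :
    π.map (fun γ : C(I, X) => γ t) ≪ m := by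
  obtain ⟨C, hC⟩ := h.compression
  exact (hC t).absolutelyContinuous.trans (Measure.AbsolutelyContinuous.rfl.smul_left C)

lemma IsFinitePlan.lintegral_speed_rpow_lt_top (h : IsFinitePlan m q π) :
    ∫⁻ z, metricSpeed z.1 z.2 ^ q ∂(π.prod (volume : Measure I)) < ∞ := by
  have := h.isFiniteMeasure
  rw [lintegral_prod _ (measurable_metricSpeed.pow_const q).aemeasurable]
  exact (lintegral_mono fun γ => lintegral_metricSpeed_rpow_le_kineticEnergy q γ).trans_lt h.energy

variable [BorelSpace X]

lemma measurable_eval_apply (t : I) : Measurable fun γ : C(I, X) => γ t :=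
  (continuous_eval_const t).measurable

lemma measurable_eval_prod : Measurable fun z : C(I, X) × I => z.1 z.2 :=
  continuous_eval.measurable

lemma IsFinitePlan.mono {π' : Measure C(I, X)} (h : IsFinitePlan m q π) (hle : π' ≤ π) :
    IsFinitePlan m q π' where
  isFiniteMeasure := have := h.isFiniteMeasure; isFiniteMeasure_of_le π hle
  compression :=
    let ⟨C, hC⟩ := h.compression
    ⟨C, fun t => (Measure.map_mono hle (measurable_eval_apply t)).trans (hC t)⟩
  energy := (lintegral_mono' hle le_rfl).trans_lt h.energy

/-- Tonelli and the compression bound at each time; `[0,1]` has mass one. -/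
lemma lintegral_eval_prod_le [IsFiniteMeasure π] {C : ℝ≥0}
    (hC : ∀ t : I, π.map (fun γ : C(I, X) => γ t) ≤ C • m) {g : X → ℝ≥0∞} (hg : Measurable g) :
    ∫⁻ z, g (z.1 z.2) ∂(π.prod (volume : Measure I)) ≤ C * ∫⁻ x, g x ∂m := by
  rw [lintegral_prod_symm (fun z : C(I, X) × I => g (z.1 z.2))
    (hg.comp measurable_eval_prod).aemeasurable]
  calc ∫⁻ t : I, ∫⁻ γ, g (γ t) ∂π ≤ ∫⁻ _ : I, C * ∫⁻ x, g x ∂m := by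
        refine lintegral_mono fun t => ?_
        rw [← lintegral_map hg (measurable_eval_apply t)]
        refine (lintegral_mono' (hC t) le_rfl).trans_eq ?_
        rw [lintegral_smul_measure]
        rfl
    _ = C * ∫⁻ x, g x ∂m := by simp

lemma IsFinitePlan.map_eval_prod_absolutelyContinuous (h : IsFinitePlan m q π) :
    (π.prod (volume : Measure I)).map (fun z => z.1 z.2) ≪ m := by
  have := h.isFiniteMeasure
  obtain ⟨C, hC⟩ := h.compression
  refine Measure.AbsolutelyContinuous.mk fun s hs h0 => ?_
  rw [← lintegral_indicator_one hs, lintegral_map (measurable_one.indicator hs) measurable_eval_prod]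
  refine le_antisymm ((lintegral_eval_prod_le hC (measurable_one.indicator hs)).trans ?_) zero_le
  simp [lintegral_indicator_one hs, h0]

lemma lintegral_speedMeasure {g : X → ℝ≥0∞} (hg : Measurable g) :
    ∫⁻ x, g x ∂speedMeasure π =
      ∫⁻ z, g (z.1 z.2) * metricSpeed z.1 z.2 ∂(π.prod (volume : Measure I)) := by
  rw [speedMeasure, lintegral_map hg measurable_eval_prod,
    lintegral_withDensity_eq_lintegral_mul _ measurable_metricSpeed
      (g := fun z : C(I, X) × I => g (z.1 z.2)) (hg.comp measurable_eval_prod)]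
  simp [mul_comm]

lemma IsFinitePlan.speedMeasure_absolutelyContinuous (h : IsFinitePlan m q π) :
    speedMeasure π ≪ m :=
  ((withDensity_absolutelyContinuous _ _).map measurable_eval_prod).trans
    h.map_eval_prod_absolutelyContinuous

lemma IsFinitePlan.isFiniteMeasure_speedMeasure (h : IsFinitePlan m q π) (hq : 1 < q) :
    IsFiniteMeasure (speedMeasure π) := by
  have := h.isFiniteMeasure
  refine ⟨?_⟩
  rw [← lintegral_one, lintegral_speedMeasure measurable_const]
  calc ∫⁻ z, 1 * metricSpeed z.1 z.2 ∂(π.prod (volume : Measure I))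
      -- Pointwise `v ≤ 1 + v^q`, as `q > 1`.
      ≤ ∫⁻ z, (1 + metricSpeed z.1 z.2 ^ q) ∂(π.prod (volume : Measure I)) := by
        refine lintegral_mono fun z => ?_
        rw [one_mul]
        rcases le_total (metricSpeed z.1 z.2) 1 with h1 | h1
        · exact h1.trans le_self_add
        · refine le_trans ?_ le_add_self
          simpa using ENNReal.rpow_le_rpow_of_exponent_le h1 hq.le
    _ = π.prod (volume : Measure I) Set.univ +
        ∫⁻ z, metricSpeed z.1 z.2 ^ q ∂(π.prod (volume : Measure I)) := by
        rw [lintegral_add_left measurable_const, lintegral_one]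
    _ < ∞ := ENNReal.add_lt_top.2 ⟨measure_lt_top _ _, h.lintegral_speed_rpow_lt_top⟩

/-- Hölder on the product of curves and times: compression controls the factor with `g`, the energy
the factor with the speed. -/
lemma IsFinitePlan.exists_lintegral_speedMeasure_le (h : IsFinitePlan m q π)
    (hpq : p.HolderConjugate q) :
    ∃ K : ℝ≥0∞, K ≠ ∞ ∧ ∀ g : X → ℝ≥0∞, Measurable g →
      ∫⁻ x, g x ∂speedMeasure π ≤ K * (∫⁻ x, g x ^ p ∂m) ^ (1 / p) := by
  have := h.isFiniteMeasure
  have hp := hpq.pos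
  have hq := hpq.symm.pos
  obtain ⟨C, hC⟩ := h.compression
  set E := ∫⁻ z, metricSpeed z.1 z.2 ^ q ∂(π.prod (volume : Measure I)) with hE
  refine ⟨(C : ℝ≥0∞) ^ (1 / p) * E ^ (1 / q), ENNReal.mul_ne_top ?_ ?_, fun g hg => ?_⟩
  · exact ENNReal.rpow_ne_top_of_nonneg (by positivity) ENNReal.coe_ne_top
  · exact ENNReal.rpow_ne_top_of_nonneg (by positivity) h.lintegral_speed_rpow_lt_top.ne
  rw [lintegral_speedMeasure hg]
  calc _ ≤ (∫⁻ z, g (z.1 z.2) ^ p ∂(π.prod (volume : Measure I))) ^ (1 / p) * E ^ (1 / q) :=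
        ENNReal.lintegral_mul_le_Lp_mul_Lq _ hpq
          (f := fun z : C(I, X) × I => g (z.1 z.2)) (hg.comp measurable_eval_prod).aemeasurable
          measurable_metricSpeed.aemeasurable
    _ ≤ (C * ∫⁻ x, g x ^ p ∂m) ^ (1 / p) * E ^ (1 / q) := by
        gcongr
        exact lintegral_eval_prod_le hC (hg.pow_const p)
    _ = _ := by
        rw [ENNReal.mul_rpow_of_nonneg _ _ (by positivity)]
        ring

lemma IsFinitePlan.memLp_rnDeriv_speedMeasure [SigmaFinite m] (h : IsFinitePlan m q π)
    (hpq : p.HolderConjugate q) :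
    MemLp (fun x => ((speedMeasure π).rnDeriv m x).toReal) (ENNReal.ofReal q) m := by
  have := h.isFiniteMeasure
  have := h.isFiniteMeasure_speedMeasure hpq.symm.lt
  have hq := hpq.symm.pos
  obtain ⟨K, hKt, hK⟩ := h.exists_lintegral_speedMeasure_le hpq
  have hmeas := Measure.measurable_rnDeriv (speedMeasure π) m
  have hle : ∫⁻ x, (speedMeasure π).rnDeriv m x ^ q ∂m ≤ K ^ q := by
    refine lintegral_rpow_le_of_forall_lintegral_mul_le hpq hmeas fun g hg => ?_
    refine le_trans (le_of_eq ?_) (hK g hg)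
    conv_rhs => rw [← Measure.withDensity_rnDeriv_eq _ _ h.speedMeasure_absolutelyContinuous]
    rw [lintegral_withDensity_eq_lintegral_mul _ hmeas hg]
    simp [mul_comm]
  refine ⟨hmeas.ennreal_toReal.aestronglyMeasurable, ?_⟩
  rw [eLpNorm_lt_top_iff_lintegral_rpow_enorm_lt_top (by simpa using hq) ENNReal.ofReal_ne_top,
    ENNReal.toReal_ofReal hq.le]
  refine lt_of_le_of_lt (lintegral_mono fun x => ?_)
    (hle.trans_lt (ENNReal.rpow_lt_top_of_nonneg hq.le hKt))
  refine ENNReal.rpow_le_rpow ?_ hq.le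
  rw [Real.enorm_of_nonneg ENNReal.toReal_nonneg]
  exact ENNReal.ofReal_toReal_le

/-- `G` may be replaced by a Borel representative: almost every curve meets an `m`-null set only at
a null set of times. -/
lemma IsFinitePlan.lintegral_curveIntegral (h : IsFinitePlan m q π) {G : X → ℝ}
    (hG : AEMeasurable G m) :
    ∫⁻ γ, curveIntegral G γ ∂π = ∫⁻ x, ENNReal.ofReal (G x) ∂speedMeasure π := by
  have := h.isFiniteMeasure
  have hG' : Measurable fun x => ENNReal.ofReal (hG.mk G x) := hG.measurable_mk.ennreal_ofReal
  have hae : ∀ᵐ z ∂(π.prod (volume : Measure I)), G (z.1 z.2) = hG.mk G (z.1 z.2) :=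
    ae_of_ae_map measurable_eval_prod.aemeasurable
      (h.map_eval_prod_absolutelyContinuous.ae_le hG.ae_eq_mk)
  calc ∫⁻ γ, curveIntegral G γ ∂π
      = ∫⁻ γ, (∫⁻ t : I, ENNReal.ofReal (hG.mk G (γ t)) * metricSpeed γ t) ∂π := by
        refine lintegral_congr_ae ?_
        filter_upwards [Measure.ae_ae_of_ae_prod hae] with γ hγ
        refine lintegral_congr_ae ?_
        filter_upwards [hγ] with t ht
        rw [ht]
    _ = ∫⁻ x, ENNReal.ofReal (hG.mk G x) ∂speedMeasure π := by
        rw [lintegral_speedMeasure hG', lintegral_prod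
          (fun z : C(I, X) × I => ENNReal.ofReal (hG.mk G (z.1 z.2)) * metricSpeed z.1 z.2)
          ((hG'.comp measurable_eval_prod).mul measurable_metricSpeed).aemeasurable]
    _ = ∫⁻ x, ENNReal.ofReal (G x) ∂speedMeasure π := by
        refine lintegral_congr_ae ?_
        filter_upwards [h.speedMeasure_absolutelyContinuous.ae_le hG.ae_eq_mk] with x hx
        rw [hx]

lemma IsFinitePlan.lintegral_ofReal_speedMeasure_lt_top (h : IsFinitePlan m q π)
    (hpq : p.HolderConjugate q) {G : X → ℝ} (hG : MemLp G (ENNReal.ofReal p) m) :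
    ∫⁻ x, ENNReal.ofReal (G x) ∂speedMeasure π < ∞ := by
  have hp := hpq.pos
  have hGm := hG.1.aemeasurable
  obtain ⟨K, hKt, hK⟩ := h.exists_lintegral_speedMeasure_le hpq
  have h1 : ∫⁻ x, ‖hGm.mk G x‖ₑ ^ p ∂m < ∞ := by
    have h2 := lintegral_rpow_enorm_lt_top_of_eLpNorm_lt_top (by simpa using hp)
      ENNReal.ofReal_ne_top hG.2
    rw [ENNReal.toReal_ofReal hp.le] at h2
    refine lt_of_eq_of_lt (lintegral_congr_ae ?_) h2
    filter_upwards [hGm.ae_eq_mk] with x hx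
    rw [hx]
  calc ∫⁻ x, ENNReal.ofReal (G x) ∂speedMeasure π
      ≤ ∫⁻ x, ‖hGm.mk G x‖ₑ ∂speedMeasure π := by
        refine lintegral_mono_ae ?_
        filter_upwards [h.speedMeasure_absolutelyContinuous.ae_le hGm.ae_eq_mk] with x hx
        rw [hx]
        exact Real.ofReal_le_enorm _
    _ ≤ _ := hK _ hGm.measurable_mk.enorm
    _ < ∞ := ENNReal.mul_lt_top hKt.lt_top (ENNReal.rpow_lt_top_of_nonneg (by positivity) h1.ne)

end Plans

/-! ### Combining plans, and a countable dense family. -/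

section Construction

variable {X : Type*} [MetricSpace X] [MeasurableSpace X] {m : Measure X} {p q : ℝ}

lemma IsFinitePlan.isTestPlan_smul {π : Measure C(I, X)} (h : IsFinitePlan m q π) (h0 : π ≠ 0) :
    IsTestPlan m q ((π Set.univ)⁻¹ • π) := by
  have := h.isFiniteMeasure
  have : NeZero π := ⟨h0⟩
  have hct : (π Set.univ)⁻¹ ≠ ∞ := ENNReal.inv_ne_top.2 (NeZero.ne _)
  obtain ⟨C, hC⟩ := h.compression
  -- The summand `1` only makes the compression constant positive.
  refine ⟨inferInstance, ⟨(π Set.univ)⁻¹.toNNReal * C + 1, by positivity, fun t => ?_⟩, ?_⟩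
  · rw [Measure.map_smul]
    refine Measure.le_iff.2 fun s _ => ?_
    have h1 := Measure.le_iff'.1 (hC t) s
    simp only [Measure.smul_apply, smul_eq_mul, Measure.nnreal_smul_coe_apply] at h1 ⊢
    calc _ ≤ (π Set.univ)⁻¹ * (C * m s) := by gcongr
      _ = ((π Set.univ)⁻¹ * C) * m s := by ring
      _ ≤ ((π Set.univ)⁻¹ * C + 1) * m s := by gcongr; exact le_self_add
      _ = _ := by push_cast; rw [ENNReal.coe_toNNReal hct]
  · rw [lintegral_smul_measure]
    exact ENNReal.mul_lt_top hct.lt_top h.energy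

variable [BorelSpace X]

/-- Countably many finite plans are simultaneously absolutely continuous with respect to a single
one. -/
lemma exists_isFinitePlan_forall_absolutelyContinuous {π : ℕ → Measure C(I, X)}
    (h : ∀ k, IsFinitePlan m q (π k)) :
    ∃ ν, IsFinitePlan m q ν ∧ ∀ k, π k ≪ ν := by
  have := fun k => (h k).isFiniteMeasure
  choose C hC using fun k => (h k).compression
  obtain ⟨ε, hε0, hε1⟩ := ENNReal.exists_pos_sum_of_countable one_ne_zero ℕ
  -- `D k` dominates mass, compression and energy at once, so the weights `ε k / D k` make all three
  -- sums at most one; the leading `1` keeps `D k` nonzero.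
  set D : ℕ → ℝ≥0∞ := fun k => 1 + π k Set.univ + C k + ∫⁻ γ, kineticEnergy q γ ∂π k with hD
  have hDt : ∀ k, D k ≠ ∞ := fun k => by
    have h1 := (h k).energy.ne
    have h2 := measure_ne_top (π k) Set.univ
    simp [hD, h1, h2]
  have hD0 : ∀ k, D k ≠ 0 := fun k => by simp [hD]
  set c : ℕ → ℝ≥0∞ := fun k => ε k / D k with hc
  have hc0 : ∀ k, c k ≠ 0 := fun k =>
    ENNReal.div_ne_zero.2 ⟨by simpa using (hε0 k).ne', hDt k⟩
  have hcle : ∀ {a : ℕ → ℝ≥0∞}, (∀ k, a k ≤ D k) → ∑' k, c k * a k ≤ 1 := fun {a} ha => by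
    refine (ENNReal.tsum_le_tsum fun k => ?_).trans hε1.le
    calc c k * a k ≤ c k * D k := by gcongr; exact ha k
      _ = ε k := ENNReal.div_mul_cancel (hD0 k) (hDt k)
  refine ⟨Measure.sum fun k => c k • π k, ⟨⟨?_⟩, ⟨1, fun t => ?_⟩, ?_⟩, fun k =>
    Measure.absolutelyContinuous_sum_right k (Measure.absolutelyContinuous_smul (hc0 k))⟩
  · rw [Measure.sum_apply _ MeasurableSet.univ]
    refine lt_of_le_of_lt (hcle (a := fun k => π k Set.univ) fun k => ?_) ENNReal.one_lt_top
    exact le_add_self.trans (le_self_add.trans le_self_add)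
  · rw [Measure.map_sum (measurable_eval_apply t).aemeasurable]
    refine Measure.le_iff.2 fun s hs => ?_
    rw [Measure.sum_apply _ hs, one_smul]
    calc ∑' k, (c k • π k).map (fun γ : C(I, X) => γ t) s
        ≤ ∑' k, c k * C k * m s := by
          refine ENNReal.tsum_le_tsum fun k => ?_
          have h1 := Measure.le_iff'.1 (hC k t) s
          rw [Measure.map_smul, Measure.smul_apply, smul_eq_mul, mul_assoc]
          gcongr
          exact h1
      _ = (∑' k, c k * C k) * m s := ENNReal.tsum_mul_right
      _ ≤ 1 * m s := by
          gcongr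
          exact hcle fun k => le_add_self.trans le_self_add
      _ = m s := one_mul _
  · rw [lintegral_sum_measure]
    simp only [lintegral_smul_measure, smul_eq_mul]
    exact lt_of_le_of_lt (hcle fun k => le_add_self) ENNReal.one_lt_top

/-- Constant curves starting in a bounded set form a nontrivial finite plan. -/
lemma exists_isFinitePlan_ne_zero (hm_ne : m ≠ 0)
    (hm_bdd : ∀ s : Set X, Bornology.IsBounded s → m s < ∞) (hq : 0 < q) :
    ∃ π : Measure C(I, X), IsFinitePlan m q π ∧ π ≠ 0 := by
  have hne : Nonempty X := by
    by_contra hX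
    rw [not_nonempty_iff] at hX
    exact hm_ne (Measure.eq_zero_of_isEmpty m)
  obtain ⟨x₀⟩ := hne
  obtain ⟨n, hn⟩ : ∃ n : ℕ, m (Metric.ball x₀ n) ≠ 0 := by
    by_contra! hall
    refine hm_ne (Measure.measure_univ_eq_zero.1 ?_)
    rw [← Metric.iUnion_ball_nat x₀]
    exact measure_iUnion_null hall
  have hcm : Measurable fun x : X => ContinuousMap.const I x :=
    ContinuousMap.continuous_const'.measurable
  set ρ := m.restrict (Metric.ball x₀ n)
  have hρ : IsFiniteMeasure ρ := ⟨by simpa [ρ] using hm_bdd _ Metric.isBounded_ball⟩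
  refine ⟨ρ.map fun x => ContinuousMap.const I x, ⟨inferInstance, ⟨1, fun t => ?_⟩, ?_⟩, ?_⟩
  · rw [Measure.map_map (measurable_eval_apply t) hcm, one_smul]
    have : (fun γ : C(I, X) => γ t) ∘ (fun x : X => ContinuousMap.const I x) = id := by
      ext; simp
    rw [this, Measure.map_id]
    exact Measure.restrict_le_self
  -- This inequality needs no measurability of `kineticEnergy`.
  · refine lt_of_le_of_lt (lintegral_map_le _ _) ?_
    simp [kineticEnergy_const hq]
  · rw [Ne, Measure.map_eq_zero_iff hcm.aemeasurable, Measure.restrict_eq_zero]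
    exact hn

/-- A countable family of finite plans that decides the integrated upper gradient inequality for
bounded functions. -/
lemma exists_seq_isFinitePlan_dense [MeasurableSpace.CountablyGenerated X] [SigmaFinite m]
    (hpq : p.HolderConjugate q) :
    ∃ π : ℕ → Measure C(I, X), (∀ k, IsFinitePlan m q (π k)) ∧
      ∀ f G : X → ℝ, MemLp f ∞ m → MemLp G (ENNReal.ofReal p) m →
        (∀ k, ∫ x, f x ∂(π k).map (fun γ : C(I, X) => γ 1) -
          ∫ x, f x ∂(π k).map (fun γ : C(I, X) => γ 0) ≤ ∫ x, G x ∂speedMeasure (π k)) →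
        ∀ π' : Measure C(I, X), IsFinitePlan m q π' →
          ∫ x, f x ∂π'.map (fun γ : C(I, X) => γ 1) -
            ∫ x, f x ∂π'.map (fun γ : C(I, X) => γ 0) ≤ ∫ x, G x ∂speedMeasure π' := by
  have : Fact (1 ≤ ENNReal.ofReal p) := ⟨by simpa using hpq.lt.le⟩
  have : Fact (1 ≤ ENNReal.ofReal q) := ⟨by simpa using hpq.symm.lt.le⟩
  -- Finite exponents make `L^q` and `L¹` separable.
  have : Fact (ENNReal.ofReal q ≠ ∞) := ⟨ENNReal.ofReal_ne_top⟩
  have : Fact ((1 : ℝ≥0∞) ≠ ∞) := ⟨ENNReal.one_ne_top⟩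
  have : (ENNReal.ofReal p).HolderConjugate (ENNReal.ofReal q) := hpq.ennrealOfReal
  let P := {π : Measure C(I, X) // IsFinitePlan m q π}
  have hPe : ∀ (π : P) (t : I),
      MemLp (fun x => ((π.1.map fun γ : C(I, X) => γ t).rnDeriv m x).toReal) 1 m := fun π t => by
    have := π.2.isFiniteMeasure
    exact memLp_one_iff_integrable.2 Measure.integrable_toReal_rnDeriv
  have hPs : ∀ π : P,
      MemLp (fun x => ((speedMeasure π.1).rnDeriv m x).toReal) (ENNReal.ofReal q) m :=
    fun π => π.2.memLp_rnDeriv_speedMeasure hpq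
  let T : P → Lp ℝ 1 m × Lp ℝ 1 m × Lp ℝ (ENNReal.ofReal q) m := fun π =>
    ((hPe π 0).toLp _, (hPe π 1).toLp _, (hPs π).toLp _)
  have : Nonempty P := ⟨⟨0, isFinitePlan_zero⟩⟩
  have : Nonempty (Set.range T) := (Set.range_nonempty T).to_subtype
  -- Density is taken within the range of `T`, so that each approximating triple comes from a plan.
  choose π hπ using fun k => (TopologicalSpace.denseSeq (Set.range T) k).2
  refine ⟨fun k => (π k).1, fun k => (π k).2, fun f G hf hG hk π' hπ' => ?_⟩
  let Φ : Lp ℝ 1 m × Lp ℝ 1 m × Lp ℝ (ENNReal.ofReal q) m → ℝ := fun z =>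
    (ContinuousLinearMap.mul ℝ ℝ).lpPairing m ∞ 1 (hf.toLp f) z.2.1 -
      (ContinuousLinearMap.mul ℝ ℝ).lpPairing m ∞ 1 (hf.toLp f) z.1 -
      (ContinuousLinearMap.mul ℝ ℝ).lpPairing m (ENNReal.ofReal p) (ENNReal.ofReal q)
        (hG.toLp G) z.2.2
  have hΦ : Continuous Φ := by fun_prop
  have hΦT : ∀ ρ : P, Φ (T ρ) = ∫ x, f x ∂ρ.1.map (fun γ : C(I, X) => γ 1) -
      ∫ x, f x ∂ρ.1.map (fun γ : C(I, X) => γ 0) - ∫ x, G x ∂speedMeasure ρ.1 := fun ρ => by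
    have := ρ.2.isFiniteMeasure
    have := ρ.2.isFiniteMeasure_speedMeasure hpq.symm.lt
    simp only [Φ, T]
    rw [lpPairing_toLp_rnDeriv (ρ.2.map_eval_absolutelyContinuous 0),
      lpPairing_toLp_rnDeriv (ρ.2.map_eval_absolutelyContinuous 1),
      lpPairing_toLp_rnDeriv ρ.2.speedMeasure_absolutelyContinuous]
  have hmain : Φ (T ⟨π', hπ'⟩) ≤ 0 :=
    (TopologicalSpace.denseRange_denseSeq (Set.range T)).induction_on
      (p := fun z : Set.range T => Φ z ≤ 0) ⟨T ⟨π', hπ'⟩, Set.mem_range_self _⟩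
      (isClosed_le (hΦ.comp continuous_subtype_val) continuous_const) fun k => by
        rw [← hπ k, hΦT]
        exact sub_nonpos.2 (hk k)
  rw [hΦT] at hmain
  exact sub_nonpos.1 hmain

end Construction

/-! ### From the signed inequality for bounded functions to weak upper gradients. -/

section Detection

variable {X : Type*} [MetricSpace X] [MeasurableSpace X] [BorelSpace X]
  {m : Measure X} {p q : ℝ}

lemma integrable_comp_eval {π : Measure C(I, X)} [IsFiniteMeasure π] {f : X → ℝ}
    (hf : Measurable f) {N : ℝ} (hN : ∀ x, |f x| ≤ N) (t : I) :
    Integrable (fun γ : C(I, X) => f (γ t)) π :=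
  Integrable.of_bound (hf.comp (measurable_eval_apply t)).aestronglyMeasurable N
    (ae_of_all _ fun γ => hN (γ t))

lemma integral_map_eval_sub {π : Measure C(I, X)} [IsFiniteMeasure π] {f : X → ℝ}
    (hf : Measurable f) {N : ℝ} (hN : ∀ x, |f x| ≤ N) (s t : I) :
    ∫ x, f x ∂π.map (fun γ : C(I, X) => γ t) - ∫ x, f x ∂π.map (fun γ : C(I, X) => γ s) =
      ∫ γ, (f (γ t) - f (γ s)) ∂π := by
  rw [integral_map (measurable_eval_apply t).aemeasurable hf.aestronglyMeasurable,
    integral_map (measurable_eval_apply s).aemeasurable hf.aestronglyMeasurable,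
    integral_sub (integrable_comp_eval hf hN t) (integrable_comp_eval hf hN s)]

lemma IsFinitePlan.integral_speedMeasure {π : Measure C(I, X)} (h : IsFinitePlan m q π)
    {G : X → ℝ} (hG : AEMeasurable G m) (hG0 : 0 ≤ᵐ[m] G) :
    ∫ x, G x ∂speedMeasure π = (∫⁻ γ, curveIntegral G γ ∂π).toReal := by
  have hac := h.speedMeasure_absolutelyContinuous
  rw [integral_eq_lintegral_of_nonneg_ae (hac.ae_le hG0) (hG.mono_ac hac).aestronglyMeasurable,
    h.lintegral_curveIntegral hG]

lemma IsFinitePlan.lintegral_curveIntegral_lt_top {π : Measure C(I, X)}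
    (h : IsFinitePlan m q π) (hpq : p.HolderConjugate q) {G : X → ℝ}
    (hG : MemLp G (ENNReal.ofReal p) m) :
    ∫⁻ γ, curveIntegral G γ ∂π < ∞ := by
  rw [h.lintegral_curveIntegral hG.1.aemeasurable]
  exact h.lintegral_ofReal_speedMeasure_lt_top hpq hG

lemma IsFinitePlan.integral_sub_le_of_ae {π : Measure C(I, X)} (h : IsFinitePlan m q π)
    (hpq : p.HolderConjugate q) {f G : X → ℝ} (hf : Measurable f) {N : ℝ} (hN : ∀ x, |f x| ≤ N)
    (hG : MemLp G (ENNReal.ofReal p) m) (hG0 : 0 ≤ᵐ[m] G)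
    (hae : ∀ᵐ γ ∂π, ENNReal.ofReal |f (γ 1) - f (γ 0)| ≤ curveIntegral G γ) :
    ∫ x, f x ∂π.map (fun γ : C(I, X) => γ 1) - ∫ x, f x ∂π.map (fun γ : C(I, X) => γ 0) ≤
      ∫ x, G x ∂speedMeasure π := by
  have := h.isFiniteMeasure
  have hint := (integrable_comp_eval (π := π) hf hN 1).sub (integrable_comp_eval hf hN 0)
  rw [integral_map_eval_sub hf hN, h.integral_speedMeasure hG.1.aemeasurable hG0]
  calc ∫ γ, (f (γ 1) - f (γ 0)) ∂π ≤ ∫ γ, |f (γ 1) - f (γ 0)| ∂π :=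
        integral_mono hint hint.abs fun γ => le_abs_self _
    _ = (∫⁻ γ, ENNReal.ofReal |f (γ 1) - f (γ 0)| ∂π).toReal :=
        integral_eq_lintegral_of_nonneg_ae (ae_of_all _ fun γ => abs_nonneg _)
          hint.abs.aestronglyMeasurable
    _ ≤ _ := ENNReal.toReal_mono (h.lintegral_curveIntegral_lt_top hpq hG).ne
        (lintegral_mono_ae hae)

/-- The restriction of `π` to `A` is again a finite plan, and on `A` the increment of `f` equals its
absolute value. -/
lemma IsFinitePlan.setLIntegral_sub_le {π : Measure C(I, X)} (h : IsFinitePlan m q π)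
    {f G : X → ℝ} (hf : Measurable f) {N : ℝ} (hN : ∀ x, |f x| ≤ N)
    (hG : AEMeasurable G m) (hG0 : 0 ≤ᵐ[m] G)
    (hle : ∀ π' : Measure C(I, X), IsFinitePlan m q π' →
      ∫ x, f x ∂π'.map (fun γ : C(I, X) => γ 1) - ∫ x, f x ∂π'.map (fun γ : C(I, X) => γ 0) ≤
        ∫ x, G x ∂speedMeasure π')
    {A : Set C(I, X)} (hA : MeasurableSet A) (hfA : ∀ γ ∈ A, f (γ 0) ≤ f (γ 1)) :
    ∫⁻ γ in A, ENNReal.ofReal |f (γ 1) - f (γ 0)| ∂π ≤ ∫⁻ γ in A, curveIntegral G γ ∂π := by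
  have := h.isFiniteMeasure
  have hr := h.mono (Measure.restrict_le_self (s := A))
  have hint := (integrable_comp_eval (π := π.restrict A) hf hN 1).sub
    (integrable_comp_eval hf hN 0)
  have h1 := hle _ hr
  rw [integral_map_eval_sub hf hN, hr.integral_speedMeasure hG hG0] at h1
  have hnn : ∀ᵐ γ ∂π.restrict A, 0 ≤ f (γ 1) - f (γ 0) :=
    (ae_restrict_mem hA).mono fun γ hγ => sub_nonneg.2 (hfA γ hγ)
  calc ∫⁻ γ in A, ENNReal.ofReal |f (γ 1) - f (γ 0)| ∂π
      = ∫⁻ γ in A, ENNReal.ofReal (f (γ 1) - f (γ 0)) ∂π :=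
        lintegral_congr_ae (hnn.mono fun γ hγ => by simp only [abs_of_nonneg hγ])
    _ = ENNReal.ofReal (∫ γ in A, (f (γ 1) - f (γ 0)) ∂π) :=
        (ofReal_integral_eq_lintegral_ofReal hint hnn).symm
    _ ≤ _ := ENNReal.ofReal_le_of_le_toReal h1

lemma IsFinitePlan.lintegral_abs_sub_le {π : Measure C(I, X)} (h : IsFinitePlan m q π)
    {f G : X → ℝ} (hf : Measurable f) {N : ℝ} (hN : ∀ x, |f x| ≤ N)
    (hG : AEMeasurable G m) (hG0 : 0 ≤ᵐ[m] G)
    (hle : ∀ F : X → ℝ, F = f ∨ F = -f → ∀ π' : Measure C(I, X), IsFinitePlan m q π' →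
      ∫ x, F x ∂π'.map (fun γ : C(I, X) => γ 1) - ∫ x, F x ∂π'.map (fun γ : C(I, X) => γ 0) ≤
        ∫ x, G x ∂speedMeasure π') :
    ∫⁻ γ, ENNReal.ofReal |f (γ 1) - f (γ 0)| ∂π ≤ ∫⁻ γ, curveIntegral G γ ∂π := by
  have hA : MeasurableSet {γ : C(I, X) | f (γ 0) ≤ f (γ 1)} :=
    measurableSet_le (hf.comp (measurable_eval_apply 0)) (hf.comp (measurable_eval_apply 1))
  rw [← lintegral_add_compl _ hA, ← lintegral_add_compl (curveIntegral G) hA]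
  refine add_le_add (h.setLIntegral_sub_le hf hN hG hG0 (hle f (Or.inl rfl)) hA fun γ hγ => hγ)
    ?_
  have h2 := h.setLIntegral_sub_le hf.neg (N := N) (fun x => by simpa using hN x) hG hG0
    (hle (-f) (Or.inr rfl)) hA.compl
    (fun γ hγ => by simpa using (not_le.1 (show ¬ f (γ 0) ≤ f (γ 1) from hγ)).le)
  refine le_trans (le_of_eq (lintegral_congr fun γ => ?_)) h2
  rw [Pi.neg_apply, Pi.neg_apply, neg_sub_neg, abs_sub_comm]

lemma abs_clamp_sub_clamp_le (a b N : ℝ) :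
    |max (-N) (min a N) - max (-N) (min b N)| ≤ |a - b| := by
  rw [max_comm, max_comm (-N)]
  exact (abs_max_sub_max_le_abs _ _ _).trans (abs_inf_sub_inf_le_abs a b N)

/-- The integrated inequality for all truncations implies the one for the function itself. -/
lemma lintegral_abs_sub_le_of_forall_clamp {π : Measure C(I, X)} {f : X → ℝ} (hf : Measurable f)
    {a : ℝ≥0∞} (h : ∀ n : ℕ, ∫⁻ γ, ENNReal.ofReal
      |max (-(n : ℝ)) (min (f (γ 1)) n) - max (-(n : ℝ)) (min (f (γ 0)) n)| ∂π ≤ a) :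
    ∫⁻ γ, ENNReal.ofReal |f (γ 1) - f (γ 0)| ∂π ≤ a := by
  have hm : ∀ t : I, Measurable fun γ : C(I, X) => f (γ t) := fun t =>
    hf.comp (measurable_eval_apply t)
  have hlim : ∀ y : ℝ, ∀ᶠ n : ℕ in atTop, max (-(n : ℝ)) (min y n) = y := fun y => by
    obtain ⟨k, hk⟩ := exists_nat_ge |y|
    filter_upwards [eventually_ge_atTop k] with n hn
    have hyn : |y| ≤ n := hk.trans (by exact_mod_cast hn)
    rw [min_eq_left (abs_le.1 hyn).2, max_eq_right (abs_le.1 hyn).1]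
  calc ∫⁻ γ, ENNReal.ofReal |f (γ 1) - f (γ 0)| ∂π
      = ∫⁻ γ, liminf (fun n : ℕ => ENNReal.ofReal
          |max (-(n : ℝ)) (min (f (γ 1)) n) - max (-(n : ℝ)) (min (f (γ 0)) n)|) atTop ∂π := by
        refine lintegral_congr fun γ => (Tendsto.liminf_eq ?_).symm
        refine tendsto_const_nhds.congr' ?_
        filter_upwards [hlim (f (γ 1)), hlim (f (γ 0))] with n h1 h0
        rw [h1, h0]
    _ ≤ liminf (fun n : ℕ => ∫⁻ γ, ENNReal.ofReal
          |max (-(n : ℝ)) (min (f (γ 1)) n) - max (-(n : ℝ)) (min (f (γ 0)) n)| ∂π) atTop := by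
        refine lintegral_liminf_le fun n => Measurable.ennreal_ofReal ?_
        exact ((measurable_const.max ((hm 1).min measurable_const)).sub
          (measurable_const.max ((hm 0).min measurable_const))).abs
    _ ≤ a := (liminf_le_liminf (Eventually.of_forall h)).trans (by simp)

end Detection

theorem exists_isMasterTestPlan {X : Type*} [MetricSpace X]
    [TopologicalSpace.SeparableSpace X] [MeasurableSpace X] [BorelSpace X]
    (m : Measure X) (hm_ne : m ≠ 0) (hm_bdd : ∀ s : Set X, Bornology.IsBounded s → m s < ∞)
    (q : ℝ) (hq : 1 < q) : ∃ π : Measure C(I, X), IsMasterTestPlan m q π := by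
  have : SecondCountableTopology X := UniformSpace.secondCountable_of_separable X
  have : IsLocallyFiniteMeasure m :=
    ⟨fun x => ⟨Metric.ball x 1, Metric.ball_mem_nhds x one_pos, hm_bdd _ Metric.isBounded_ball⟩⟩
  have hpq : q.conjExponent.HolderConjugate q := (Real.HolderConjugate.conjExponent hq).symm
  obtain ⟨π, hπ, hdense⟩ := exists_seq_isFinitePlan_dense (m := m) hpq
  obtain ⟨π₀, hπ₀, hπ₀0⟩ := exists_isFinitePlan_ne_zero hm_ne hm_bdd (zero_lt_one.trans hq)
  -- Index `0` is reserved for the nonzero plan `π₀`, so that `ν ≠ 0` can be normalized; the dense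
  -- family is shifted by one.
  obtain ⟨ν, hν, hac⟩ := exists_isFinitePlan_forall_absolutelyContinuous
    (π := fun k => Nat.casesOn k π₀ π) (fun k => by cases k; exacts [hπ₀, hπ _])
  have hν0 : ν ≠ 0 := fun h0 => hπ₀0 (Measure.absolutelyContinuous_zero_iff.1 (h0 ▸ hac 0))
  have hfin := hν.isFiniteMeasure
  refine ⟨(ν Set.univ)⁻¹ • ν, hν.isTestPlan_smul hν0, fun f G hf hG hG0 hae => ?_⟩
  have haek : ∀ k, ∀ᵐ γ ∂π k, ENNReal.ofReal |f (γ 1) - f (γ 0)| ≤ curveIntegral G γ := fun k =>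
    ((hac (k + 1)).trans (Measure.absolutelyContinuous_smul
      (ENNReal.inv_ne_zero.2 (measure_ne_top ν _)))).ae_le hae
  have hwug : IsWeakUpperGradient m q.conjExponent f G := by
    refine ⟨hG, hG0, fun π' hπ' => lintegral_abs_sub_le_of_forall_clamp hf fun n => ?_⟩
    rw [hpq.conjExponent_eq] at hπ'
    have hn : -(n : ℝ) ≤ n := by linarith [(Nat.cast_nonneg n : (0 : ℝ) ≤ n)]
    have hFm : Measurable fun x => max (-(n : ℝ)) (min (f x) n) :=
      measurable_const.max (hf.min measurable_const)
    have hFb : ∀ x, |max (-(n : ℝ)) (min (f x) n)| ≤ n := fun x =>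
      abs_le.2 ⟨le_max_left _ _, max_le hn (min_le_right _ _)⟩
    refine hπ'.isFinitePlan.lintegral_abs_sub_le hFm hFb hG.1.aemeasurable hG0 fun F hF => ?_
    -- Truncation and change of sign do not increase increments, so the curvewise bound for `f`
    -- carries over to `F` with the same `G`.
    have hF' : Measurable F ∧ (∀ x, |F x| ≤ n) ∧ ∀ x y, |F x - F y| ≤ |f x - f y| := by
      rcases hF with rfl | rfl
      · exact ⟨hFm, hFb, fun x y => abs_clamp_sub_clamp_le _ _ _⟩
      · refine ⟨hFm.neg, fun x => by simpa using hFb x, fun x y => ?_⟩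
        rw [Pi.neg_apply, Pi.neg_apply, neg_sub_neg, abs_sub_comm]
        exact abs_clamp_sub_clamp_le _ _ _
    refine hdense F G (memLp_top_of_bound hF'.1.aestronglyMeasurable n (ae_of_all _ hF'.2.1)) hG
      fun k => (hπ k).integral_sub_le_of_ae hpq hF'.1 hF'.2.1 hG hG0 ?_
    filter_upwards [haek k] with γ hγ
    exact (ENNReal.ofReal_le_ofReal (hF'.2.2 _ _)).trans hγ
  exact ⟨⟨hf, G, hwug⟩, hwug⟩

end MasterPlan

end

theorem mainTheorem6 {X : Type*} [MetricSpace X] [CompleteSpace X]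
    [TopologicalSpace.SeparableSpace X] [MeasurableSpace X] [BorelSpace X]
    (m : MeasureTheory.Measure X) (hm_ne : m ≠ 0)
    (hm_bdd : ∀ s : Set X, Bornology.IsBounded s → m s < ⊤)
    (q : ℝ) (hq : 1 < q) :
    ∃ π : MeasureTheory.Measure C(unitInterval, X), MasterPlan.IsMasterTestPlan m q π :=
  MasterPlan.exists_isMasterTestPlan m hm_ne hm_bdd q hq
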